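/- Let $\Bbbk$ be a field, let $n>1$ be an integer, let $w$ be an integer, and let $q\in\Bbbk$ be a primitive $n$-th root of unity. Let $G=\langle g,h\rangle$ be the free abelian group on $g,h$, let $\chi\colon G\to\Bbbk^\times$ be the character with $\chi(g)=1$, $\chi(h)=q$, and let $\tilde H=\Bbbk G(\chi,h,0)$ be the corresponding Hopf-Ore extension of $\Bbbk G$: the $\Bbbk$-algebra generated by the group algebra $\Bbbk G$ and a variable $x$ subject to $xu=\chi(u)\,ux$ for $u\in G$, that is, $xg=gx$ and $xh=qhx$, with the Hopf algebra structure in which the elements of $G$ are grouplike and $\Delta(x)=1\otimes x+x\otimes h$. Let $B(n,w,q)$ be the generalized Liu algebra, that is, the Hopf algebra generated by $g^{\pm1},h^{\pm1},x$ subject to $gh=hg$, $xg=gx$, $xh=qhx$, $x^n=1-g^w=1-h^n$, with the same formulas for $\Delta$; it is a quotient Hopf algebra of $\tilde H$. Let $Q_0$ be a finite set (the vertices of a quiver) and let $\Bbbk Q_0=\bigoplus_{i\in Q_0}\Bbbk e_i$ be the algebra with $e_ie_j=\delta_{ij}e_i$ and $1=\sum_i e_i$. Suppose given a Hopf action of $\tilde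 H$ on $\Bbbk Q_0$. Then there are a unique permutation action of $G$ on $Q_0$ and a unique family of scalars $(\gamma_i)_{i\in Q_0}$ in $\Bbbk$ such that $$u\cdot e_i=e_{u\cdot i},\qquad \gamma_{u\cdot i}=\chi(u)\gamma_i,\qquad x\cdot e_i=\gamma_ie_i-q\gamma_i e_{h\cdot i}\qquad\text{for all } u\in G,\ i\in Q_0 .$$ With this permutation action and these scalars, the action of $\tilde H$ on $\Bbbk Q_0$ factors through $B(n,w,q)$ (it is the pullback of a Hopf action of $B(n,w,q)$ along the projection $\tilde H\to B(n,w,q)$) if and only if for every $i\in Q_0$ both of the following hold: 1. if $h^n\cdot i\neq i$, then $\gamma_i$ is an $n$-th root of unity, that is, $\gamma_i^n=1$; 2. $g^w\cdot i=h^n\cdot i$. -/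

import Mathlib

open scoped TensorProduct

noncomputable section

/-- A left Hopf action of a Hopf algebra `H` on an algebra `A`: an `H`-module structure on `A`
(given as an algebra map from `H` to the `k`-linear endomorphisms of `A`) with
`u · (p q) = ∑ (u₁ · p) (u₂ · q)` and `u · 1 = ε(u) 1`. -/
structure HopfAction (k H A : Type*) [Field k] [Ring H] [HopfAlgebra k H]
    [Ring A] [Algebra k A] where
  act : H →ₐ[k] Module.End k A
  act_mul : ∀ (u : H) (p q : A),
    act u (p * q) = LinearMap.mul' k A
      (TensorProduct.map (act.toLinearMap.flip p) (act.toLinearMap.flip q)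
        (Coalgebra.comul (R := k) u))
  act_one : ∀ u : H, act u 1 = algebraMap k A (Coalgebra.counit (R := k) u)

/-- The action `ρ` of `H` factors through the homomorphism `π : H → B`: it is the pullback along
`π` of a Hopf action of `B`. -/
def HopfAction.FactorsThrough {k H B A : Type*} [Field k] [Ring H] [HopfAlgebra k H]
    [Ring B] [HopfAlgebra k B] [Ring A] [Algebra k A]
    (ρ : HopfAction k H A) (π : H →ₐc[k] B) : Prop :=
  ∃ ρ' : HopfAction k B A, ∀ (u : H) (p : A), ρ.act u p = ρ'.act (π u) p

/-! ### Constructing antipodes from their values on generators -/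

section AntipodeConstruction

variable {k A : Type*} [Field k] [Ring A] [Bialgebra k A]

/-- An antihomomorphism, given as an algebra map to the opposite, as a linear endomorphism. -/
def antiLinear (S : A →ₐ[k] Aᵐᵒᵖ) : A →ₗ[k] A :=
  (MulOpposite.opLinearEquiv k).symm.toLinearMap ∘ₗ S.toLinearMap

theorem antiLinear_apply (S : A →ₐ[k] Aᵐᵒᵖ) (a : A) : antiLinear S a = (S a).unop := rfl

theorem antiLinear_mul (S : A →ₐ[k] Aᵐᵒᵖ) (a b : A) :
    antiLinear S (a * b) = antiLinear S b * antiLinear S a := by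
  simp [antiLinear_apply]

theorem antipode_left_mul (S : A →ₐ[k] Aᵐᵒᵖ) {t : A ⊗[k] A} {c : k}
    (ht : LinearMap.mul' k A ((antiLinear S).rTensor A t) = algebraMap k A c) (s : A ⊗[k] A) :
    LinearMap.mul' k A ((antiLinear S).rTensor A (t * s)) =
      algebraMap k A c * LinearMap.mul' k A ((antiLinear S).rTensor A s) := by
  induction s using TensorProduct.induction_on with
  | zero => simp
  | add x y hx hy => simp only [mul_add, map_add, hx, hy]
  | tmul b d =>
    have key : ∀ t : A ⊗[k] A, LinearMap.mul' k A ((antiLinear S).rTensor A (t * b ⊗ₜ d)) =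
        antiLinear S b * LinearMap.mul' k A ((antiLinear S).rTensor A t) * d := by
      intro t
      induction t using TensorProduct.induction_on with
      | zero => simp
      | add x y hx hy => simp only [add_mul, mul_add, map_add, hx, hy]
      | tmul a a' => simp [antiLinear_mul, mul_assoc]
    rw [key, ht, ← Algebra.commutes]
    simp [mul_assoc]

theorem antipode_right_mul (S : A →ₐ[k] Aᵐᵒᵖ) {s : A ⊗[k] A} {c : k}
    (hs : LinearMap.mul' k A ((antiLinear S).lTensor A s) = algebraMap k A c) (t : A ⊗[k] A) :
    LinearMap.mul' k A ((antiLinear S).lTensor A (t * s)) =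
      LinearMap.mul' k A ((antiLinear S).lTensor A t) * algebraMap k A c := by
  induction t using TensorProduct.induction_on with
  | zero => simp
  | add x y hx hy => simp only [add_mul, map_add, hx, hy]
  | tmul b d =>
    have key : ∀ s : A ⊗[k] A, LinearMap.mul' k A ((antiLinear S).lTensor A (b ⊗ₜ d * s)) =
        b * LinearMap.mul' k A ((antiLinear S).lTensor A s) * antiLinear S d := by
      intro s
      induction s using TensorProduct.induction_on with
      | zero => simp
      | add x y hx hy => simp only [add_mul, mul_add, map_add, hx, hy]
      | tmul a a' => simp [antiLinear_mul, mul_assoc]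
    rw [key, hs, mul_assoc, Algebra.commutes]
    simp [mul_assoc]

end AntipodeConstruction

/-! ### Hopf-Ore extensions of group algebras -/

/-- The data `(χ, h, α)` of a Hopf-Ore extension `k G(χ, h, α)` of the group algebra of `G`:
a character `χ`, a central element `h`, and a form `α` with `α(uv) = α(u) + χ(u) α(v)`. -/
structure HopfOreData (k G : Type*) [Field k] [Group G] where
  χ : G →* kˣ
  h : G
  h_central : ∀ u : G, h * u = u * h
  α : G → k
  α_mul : ∀ u v : G, α (u * v) = α u + χ u * α v

/-- Generators: the elements of the group, and the variable `x`. -/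
inductive HopfOreGen (G : Type*) where
  | grp (u : G)
  | x

variable {k G : Type*} [Field k] [Group G]

/-- The relations of the group algebra, and `x u = χ(u) u x + α(u) (1 - h) u` for `u ∈ G`. -/
inductive HopfOreRel (D : HopfOreData k G) :
    FreeAlgebra k (HopfOreGen G) → FreeAlgebra k (HopfOreGen G) → Prop where
  | one : HopfOreRel D (FreeAlgebra.ι k (.grp 1)) 1
  | mul (u v : G) : HopfOreRel D (FreeAlgebra.ι k (.grp (u * v)))
      (FreeAlgebra.ι k (.grp u) * FreeAlgebra.ι k (.grp v))
  | ore (u : G) : HopfOreRel D (FreeAlgebra.ι k .x * FreeAlgebra.ι k (.grp u))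
      ((D.χ u : k) • (FreeAlgebra.ι k (.grp u) * FreeAlgebra.ι k .x) +
        D.α u • ((1 - FreeAlgebra.ι k (.grp D.h)) * FreeAlgebra.ι k (.grp u)))

/-- The Ore extension `k G(χ, h, α) = k G[x; τ, δ]` with `τ(u) = χ(u) u` and
`δ(u) = α(u) (1 - h) u` for `u ∈ G`: the `k`-algebra generated by `k G` and `x` with
`x a = τ(a) x + δ(a)`. -/
def HopfOre (D : HopfOreData k G) : Type _ := RingQuot (HopfOreRel D)

namespace HopfOre

variable {D : HopfOreData k G}

instance : Ring (HopfOre D) := inferInstanceAs (Ring (RingQuot (HopfOreRel D)))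
instance : Algebra k (HopfOre D) := inferInstanceAs (Algebra k (RingQuot (HopfOreRel D)))

/-- The quotient map from the free algebra. -/
def mk (D : HopfOreData k G) : FreeAlgebra k (HopfOreGen G) →ₐ[k] HopfOre D :=
  RingQuot.mkAlgHom k (HopfOreRel D)

/-- The element of the Hopf-Ore extension given by `u ∈ G`. -/
def grp (D : HopfOreData k G) : G →* HopfOre D where
  toFun u := mk D (FreeAlgebra.ι k (.grp u))
  map_one' := (RingQuot.mkAlgHom_rel k (HopfOreRel.one (D := D))).trans (map_one (mk D))
  map_mul' u v := (RingQuot.mkAlgHom_rel k (HopfOreRel.mul (D := D) u v)).trans (map_mul (mk D) _ _)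

/-- The variable of the Hopf-Ore extension. -/
def x (D : HopfOreData k G) : HopfOre D := mk D (FreeAlgebra.ι k .x)

theorem x_mul_grp (u : G) : x D * grp D u =
    (D.χ u : k) • (grp D u * x D) + D.α u • ((1 - grp D D.h) * grp D u) := by
  have h := RingQuot.mkAlgHom_rel k (HopfOreRel.ore (D := D) u)
  change mk D _ = mk D _ at h
  simp only [map_mul, map_add, map_smul, map_sub, map_one] at h
  exact h

theorem grp_h_comm (u : G) : grp D D.h * grp D u = grp D u * grp D D.h := by
  rw [← map_mul, ← map_mul, D.h_central]

/-- The universal property of the Hopf-Ore extension as an algebra. -/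
def lift {A : Type*} [Ring A] [Algebra k A] (f : G →* A) (y : A)
    (hy : ∀ u, y * f u = (D.χ u : k) • (f u * y) + D.α u • ((1 - f D.h) * f u)) :
    HopfOre D →ₐ[k] A :=
  RingQuot.liftAlgHom k ⟨FreeAlgebra.lift k (fun c => match c with
    | .grp u => f u
    | .x => y), by
      intro a b hab
      cases hab with
      | one => simp
      | mul u v => simp
      | ore u => simpa using hy u⟩

section lift
variable {A : Type*} [Ring A] [Algebra k A] (f : G →* A) (y : A)
    (hy : ∀ u, y * f u = (D.χ u : k) • (f u * y) + D.α u • ((1 - f D.h) * f u))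

@[simp] theorem lift_grp (u : G) : lift f y hy (grp D u) = f u := by
  change RingQuot.liftAlgHom k _ (RingQuot.mkAlgHom k _ _) = _
  rw [RingQuot.liftAlgHom_mkAlgHom_apply]
  simp

@[simp] theorem lift_x : lift f y hy (x D) = y := by
  change RingQuot.liftAlgHom k _ (RingQuot.mkAlgHom k _ _) = _
  rw [RingQuot.liftAlgHom_mkAlgHom_apply]
  simp
end lift

theorem induction {P : HopfOre D → Prop} (hs : ∀ c : k, P (algebraMap k _ c))
    (hg : ∀ u, P (grp D u)) (hx : P (x D)) (hadd : ∀ a b, P a → P b → P (a + b))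
    (hmul : ∀ a b, P a → P b → P (a * b)) (a : HopfOre D) : P a := by
  obtain ⟨b, rfl⟩ := RingQuot.mkAlgHom_surjective k (HopfOreRel D) a
  change P (mk D b)
  induction b using FreeAlgebra.induction with
  | grade0 c => rw [AlgHom.commutes]; exact hs c
  | grade1 c => cases c with
    | grp u => exact hg u
    | x => exact hx
  | mul a b ha hb => rw [map_mul]; exact hmul _ _ ha hb
  | add a b ha hb => rw [map_add]; exact hadd _ _ ha hb

theorem algHom_ext {A : Type*} [Ring A] [Algebra k A] {φ ψ : HopfOre D →ₐ[k] A}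
    (hg : ∀ u, φ (grp D u) = ψ (grp D u)) (hx : φ (x D) = ψ (x D)) : φ = ψ := by
  ext a
  induction a using induction with
  | hs c => simp
  | hg u => exact hg u
  | hx => exact hx
  | hadd a b ha hb => simp [ha, hb]
  | hmul a b ha hb => simp [ha, hb]

/-- The map `u ↦ u ⊗ u` on `G`. -/
def grpDiag (D : HopfOreData k G) : G →* HopfOre D ⊗[k] HopfOre D where
  toFun u := grp D u ⊗ₜ grp D u
  map_one' := by rw [map_one]; rfl
  map_mul' u v := by rw [map_mul, Algebra.TensorProduct.tmul_mul_tmul]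

@[simp] theorem grpDiag_apply (u : G) : grpDiag D u = grp D u ⊗ₜ[k] grp D u := rfl

/-- The map `u ↦ u⁻¹` on `G`, as a homomorphism to the opposite algebra. -/
def grpInv (D : HopfOreData k G) : G →* (HopfOre D)ᵐᵒᵖ where
  toFun u := MulOpposite.op (grp D u⁻¹)
  map_one' := by rw [inv_one, map_one]; rfl
  map_mul' u v := by rw [mul_inv_rev, map_mul, MulOpposite.op_mul]

@[simp] theorem grpInv_apply (u : G) : grpInv D u = MulOpposite.op (grp D u⁻¹) := rfl

/-- The comultiplication: `Δ(u) = u ⊗ u` for `u ∈ G` and `Δ(x) = 1 ⊗ x + x ⊗ h`. -/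
def comulHom (D : HopfOreData k G) : HopfOre D →ₐ[k] HopfOre D ⊗[k] HopfOre D :=
  lift (grpDiag D) (1 ⊗ₜ x D + x D ⊗ₜ grp D D.h) (by
    intro u
    simp only [grpDiag_apply, add_mul, mul_add,
      Algebra.TensorProduct.tmul_mul_tmul, one_mul, mul_one, x_mul_grp, sub_mul, smul_add,
      TensorProduct.tmul_add, TensorProduct.add_tmul, TensorProduct.tmul_smul,
      TensorProduct.smul_tmul', TensorProduct.tmul_sub, TensorProduct.sub_tmul, smul_sub,
      grp_h_comm]
    abel)

/-- The counit: `ε(u) = 1` for `u ∈ G` and `ε(x) = 0`. -/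
def counitHom (D : HopfOreData k G) : HopfOre D →ₐ[k] k :=
  lift 1 0 (by simp)

/-- The antipode: `S(u) = u⁻¹` for `u ∈ G` and `S(x) = -x h⁻¹`. -/
def antipodeHom (D : HopfOreData k G) : HopfOre D →ₐ[k] (HopfOre D)ᵐᵒᵖ :=
  lift (grpInv D) (MulOpposite.op (-(x D * grp D D.h⁻¹))) (by
    intro u
    apply MulOpposite.unop_injective
    have h1 : grp D u⁻¹ * grp D u = 1 := by rw [← map_mul, inv_mul_cancel, map_one]
    have h2 : grp D u * grp D u⁻¹ = 1 := by rw [← map_mul, mul_inv_cancel, map_one]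
    have h3 : grp D D.h * grp D D.h⁻¹ = 1 := by rw [← map_mul, mul_inv_cancel, map_one]
    have h4 : grp D D.h⁻¹ * grp D u⁻¹ = grp D u⁻¹ * grp D D.h⁻¹ := by
      rw [← map_mul, ← map_mul, ← mul_inv_rev, ← mul_inv_rev, D.h_central]
    have h5 : grp D u⁻¹ * x D = (D.χ u : k) • (x D * grp D u⁻¹) +
        D.α u • (grp D u⁻¹ * (1 - grp D D.h)) := by
      have h6 := congrArg (fun z => grp D u⁻¹ * z * grp D u⁻¹) (x_mul_grp (D := D) u)
      simp only [mul_add, add_mul, mul_smul_comm, smul_mul_assoc] at h6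
      rw [mul_assoc, mul_assoc, h2, mul_one] at h6
      rw [h6]
      congr 2
      · rw [← mul_assoc, h1, one_mul]
      · rw [mul_assoc, mul_assoc, h2, mul_one]
    simp only [grpInv_apply, MulOpposite.unop_mul, MulOpposite.unop_op, MulOpposite.unop_add,
      MulOpposite.unop_smul, MulOpposite.unop_sub, MulOpposite.unop_one]
    rw [mul_neg, ← mul_assoc, h5, neg_mul, mul_assoc (x D), h4, add_mul, neg_add, smul_mul_assoc,
      smul_mul_assoc, mul_assoc (grp D u⁻¹), sub_mul, one_mul, h3, mul_assoc (x D)]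
    congr 1
    · rw [smul_neg]
    · rw [← smul_neg, ← mul_neg, neg_sub])

instance : Bialgebra k (HopfOre D) :=
  Bialgebra.ofAlgHom (comulHom D) (counitHom D)
    (by
      apply algHom_ext
      · intro u; simp [comulHom]
      · simp [comulHom, TensorProduct.tmul_add, TensorProduct.add_tmul,
          Algebra.TensorProduct.one_def]
        abel)
    (by
      apply algHom_ext
      · intro u; simp [comulHom, counitHom]
      · simp [comulHom, counitHom])
    (by
      apply algHom_ext
      · intro u; simp [comulHom, counitHom]
      · simp [comulHom, counitHom])

@[simp] theorem comul_grp (u : G) :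
    Coalgebra.comul (R := k) (grp D u) = grp D u ⊗ₜ[k] grp D u := lift_grp _ _ _ u

@[simp] theorem comul_x :
    Coalgebra.comul (R := k) (x D) = 1 ⊗ₜ[k] x D + x D ⊗ₜ[k] grp D D.h := lift_x _ _ _

@[simp] theorem counit_grp (u : G) : Coalgebra.counit (R := k) (grp D u) = 1 := lift_grp _ _ _ u

@[simp] theorem counit_x : Coalgebra.counit (R := k) (x D) = 0 := lift_x _ _ _

theorem antiLinear_grp (u : G) : antiLinear (antipodeHom D) (grp D u) = grp D u⁻¹ := by
  simp [antiLinear_apply, antipodeHom]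

theorem antiLinear_x : antiLinear (antipodeHom D) (x D) = -(x D * grp D D.h⁻¹) := by
  simp [antiLinear_apply, antipodeHom]

theorem antiLinear_one : antiLinear (antipodeHom D) 1 = 1 := by
  simp [antiLinear_apply]

instance : HopfAlgebra k (HopfOre D) where
  antipode := antiLinear (antipodeHom D)
  mul_antipode_rTensor_comul := by
    ext a
    simp only [LinearMap.comp_apply, Algebra.linearMap_apply]
    induction a using induction with
    | hs c => simp [Algebra.algebraMap_eq_smul_one, Algebra.TensorProduct.one_def, antiLinear_one]
    | hg u => simp [antiLinear_grp, ← map_mul]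
    | hx => simp [antiLinear_x, antiLinear_one, mul_assoc, ← map_mul]
    | hadd a b ha hb => simp only [map_add, ha, hb]
    | hmul a b ha hb =>
      rw [Bialgebra.comul_mul, antipode_left_mul _ ha, hb, Bialgebra.counit_mul, map_mul]
  mul_antipode_lTensor_comul := by
    ext a
    simp only [LinearMap.comp_apply, Algebra.linearMap_apply]
    induction a using induction with
    | hs c => simp [Algebra.algebraMap_eq_smul_one, Algebra.TensorProduct.one_def, antiLinear_one]
    | hg u => simp [antiLinear_grp, ← map_mul]
    | hx => simp [antiLinear_x, antiLinear_grp]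
    | hadd a b ha hb => simp only [map_add, ha, hb]
    | hmul a b ha hb =>
      rw [Bialgebra.comul_mul, antipode_right_mul _ hb, ha, Bialgebra.counit_mul, map_mul]

end HopfOre

/-! ### The binomial formula for `q`-commuting elements -/

section QBinomial

variable {R : Type*} [Ring R] [Algebra k R]

/-- Gaussian binomial coefficients `[a + b choose a]_q`. -/
def qCoeff (q : k) : ℕ → ℕ → k
  | 0, _ => 1
  | _ + 1, 0 => 1
  | a + 1, b + 1 => qCoeff q a (b + 1) + q ^ (a + 1) * qCoeff q (a + 1) b

theorem qCoeff_zero_right (q : k) (a : ℕ) : qCoeff q a 0 = 1 := by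
  cases a <;> simp [qCoeff]

theorem qCoeff_zero_left (q : k) (b : ℕ) : qCoeff q 0 b = 1 := by
  simp [qCoeff]

theorem qCoeff_mul (q : k) (a b : ℕ) :
    qCoeff q a b * (∏ i ∈ Finset.range a, (1 - q ^ (i + 1))) *
      (∏ i ∈ Finset.range b, (1 - q ^ (i + 1))) =
      ∏ i ∈ Finset.range (a + b), (1 - q ^ (i + 1)) := by
  induction a generalizing b with
  | zero => simp [qCoeff_zero_left]
  | succ a iha =>
    induction b with
    | zero => simp [qCoeff_zero_right]
    | succ b ihb =>
      have h1 := iha (b + 1)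
      rw [show a + 1 + (b + 1) = a + 1 + b + 1 by ring, Finset.prod_range_succ _ (a + 1 + b)]
      rw [show a + (b + 1) = a + 1 + b by ring] at h1
      rw [Finset.prod_range_succ _ b] at h1 ⊢
      rw [Finset.prod_range_succ _ a] at ihb ⊢
      simp only [qCoeff]
      linear_combination (1 - q ^ (a + 1)) * h1 + q ^ (a + 1) * (1 - q ^ (b + 1)) * ihb

theorem qCoeff_eq_zero {q : k} {n : ℕ} (hq : IsPrimitiveRoot q n) {a b : ℕ} (ha : 0 < a)
    (hb : 0 < b) (hab : a + b = n) : qCoeff q a b = 0 := by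
  have h := qCoeff_mul q a b
  have hne : ∀ c, c < n → ∏ i ∈ Finset.range c, (1 - q ^ (i + 1)) ≠ 0 := by
    intro c hc
    rw [Finset.prod_ne_zero_iff]
    intro i hi h0
    rw [Finset.mem_range] at hi
    exact hq.pow_ne_one_of_pos_of_lt (Nat.succ_ne_zero i) (by omega) (sub_eq_zero.mp h0).symm
  have hz : ∏ i ∈ Finset.range (a + b), (1 - q ^ (i + 1)) = 0 := by
    apply Finset.prod_eq_zero (i := n - 1) (Finset.mem_range.mpr (by omega))
    rw [Nat.sub_add_cancel (by omega), hq.pow_eq_one, sub_self]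
  rw [hz, mul_assoc] at h
  exact (mul_eq_zero.mp h).resolve_right
    (mul_ne_zero (hne a (by omega)) (hne b (by omega)))

theorem qComm_pow {q : k} {X Y : R} (h : X * Y = q • (Y * X)) (a : ℕ) :
    X * Y ^ a = q ^ a • (Y ^ a * X) := by
  induction a with
  | zero => simp
  | succ a ih =>
    rw [pow_succ, ← mul_assoc, ih, smul_mul_assoc, mul_assoc, h, mul_smul_comm, smul_smul,
      ← pow_succ, mul_assoc]

theorem qBinomial {q : k} {X Y : R} (h : X * Y = q • (Y * X)) (m : ℕ) :
    (X + Y) ^ m =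
      ∑ p ∈ Finset.HasAntidiagonal.antidiagonal m, qCoeff q p.1 p.2 • (Y ^ p.1 * X ^ p.2) := by
  induction m with
  | zero => simp [qCoeff]
  | succ m ih =>
    let u : ℕ → ℕ → k := fun a b => match a with
      | 0 => 0
      | a + 1 => qCoeff q a b
    let v : ℕ → ℕ → k := fun a b => match b with
      | 0 => 0
      | b + 1 => q ^ a * qCoeff q a b
    have huv : ∀ p ∈ Finset.HasAntidiagonal.antidiagonal (m + 1),
        qCoeff q p.1 p.2 • (Y ^ p.1 * X ^ p.2) =
          u p.1 p.2 • (Y ^ p.1 * X ^ p.2) + v p.1 p.2 • (Y ^ p.1 * X ^ p.2) := by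
      rintro ⟨a, b⟩ hab
      rw [← add_smul]
      congr 1
      rcases a with _ | a <;> rcases b with _ | b <;>
        simp [u, v, qCoeff, qCoeff_zero_left, qCoeff_zero_right] at hab ⊢
    rw [Finset.sum_congr rfl huv, Finset.sum_add_distrib, Finset.Nat.sum_antidiagonal_succ,
      Finset.Nat.sum_antidiagonal_succ', pow_succ', ih, add_mul, add_comm, Finset.mul_sum,
      Finset.mul_sum]
    simp only [u, v, zero_smul, zero_add]
    congr 1
    · apply Finset.sum_congr rfl
      intro p _
      rw [mul_smul_comm, pow_succ', mul_assoc]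
    · apply Finset.sum_congr rfl
      intro p _
      rw [mul_smul_comm, ← mul_assoc, qComm_pow h, smul_mul_assoc, smul_smul, mul_assoc,
        ← pow_succ', mul_comm]

theorem add_pow_of_qComm {q : k} {n : ℕ} (hn : 0 < n) (hq : IsPrimitiveRoot q n) {X Y : R}
    (h : X * Y = q • (Y * X)) : (X + Y) ^ n = X ^ n + Y ^ n := by
  rw [qBinomial h]
  obtain ⟨m, rfl⟩ : ∃ m, n = m + 1 := ⟨n - 1, by omega⟩
  rw [Finset.Nat.antidiagonal_succ, Finset.sum_cons, Finset.sum_map]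
  cases m with
  | zero => simp [qCoeff]
  | succ m =>
    rw [Finset.Nat.antidiagonal_succ', Finset.sum_cons, Finset.sum_map, Finset.sum_eq_zero]
    · simp [qCoeff]
    · intro p hp
      rw [Finset.HasAntidiagonal.mem_antidiagonal] at hp
      rw [qCoeff_eq_zero hq, zero_smul]
      · simp
      · simp
      · simp; omega

theorem neg_one_pow_mul_q_pow {q : k} {n : ℕ} (hn : 0 < n) (hq : IsPrimitiveRoot q n) :
    (-1 : k) ^ n * q ^ (∑ i ∈ Finset.range n, i) = -1 := by
  have hs := Finset.sum_range_id_mul_two n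
  rcases Nat.even_or_odd' n with ⟨m, rfl | rfl⟩
  · have h1 : ∑ i ∈ Finset.range (2 * m), i = m * (2 * (m - 1) + 1) := by
      obtain ⟨c, rfl⟩ : ∃ c, m = c + 1 := ⟨m - 1, by omega⟩
      rw [show 2 * (c + 1) - 1 = 2 * c + 1 by omega] at hs
      simp only [Nat.add_sub_cancel]
      nlinarith
    have h2 : q ^ m = -1 := by
      have h3 : (q ^ m) ^ 2 = 1 := by rw [← pow_mul, mul_comm m 2, hq.pow_eq_one]
      exact (mul_self_eq_one_iff.mp (by rw [← sq]; exact h3)).resolve_left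
        (hq.pow_ne_one_of_pos_of_lt (by omega) (by omega))
    rw [h1, pow_mul q, h2, pow_mul, pow_succ (-1 : k) (2 * (m - 1)), pow_mul]
    simp
  · have h1 : ∑ i ∈ Finset.range (2 * m + 1), i = (2 * m + 1) * m := by
      simp only [Nat.add_sub_cancel] at hs
      nlinarith
    rw [h1, pow_mul, hq.pow_eq_one, pow_succ, pow_mul]
    simp

/-- If `z x = q x z`, then `(-x z) ^ n = -x ^ n z ^ n` for a primitive `n`-th root of unity. -/
theorem neg_mul_pow_of_qComm {q : k} {n : ℕ} (hn : 0 < n) (hq : IsPrimitiveRoot q n) {X Z : R}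
    (h : Z * X = q • (X * Z)) : (-(X * Z)) ^ n = -(X ^ n * Z ^ n) := by
  have key : ∀ m : ℕ, (X * Z) ^ m = q ^ (∑ i ∈ Finset.range m, i) • (X ^ m * Z ^ m) := by
    intro m
    induction m with
    | zero => simp
    | succ m ih =>
      have h2 : Z ^ m * X = q ^ m • (X * Z ^ m) := by
        clear ih
        induction m with
        | zero => simp
        | succ m ih =>
          rw [pow_succ', mul_assoc, ih, mul_smul_comm, ← mul_assoc, h, smul_mul_assoc, smul_smul,
            mul_assoc, ← pow_succ]
      rw [pow_succ, ih, Finset.sum_range_succ, pow_add, smul_mul_assoc, mul_assoc,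
        ← mul_assoc (Z ^ m), h2, smul_mul_assoc, mul_smul_comm, smul_smul, pow_succ X, pow_succ Z]
      simp only [mul_assoc]
  have h3 : (-(X * Z)) ^ n = ((-1 : k) ^ n) • (X * Z) ^ n := by
    rw [neg_pow, Algebra.smul_def]
    simp
  rw [h3, key, smul_smul, neg_one_pow_mul_q_pow hn hq, neg_one_smul]

end QBinomial

/-! ### The Hopf algebra `H̃` and the generalized Liu algebras -/

section GeneralizedLiu

/-- The free abelian group on two generators `g` and `h`. -/
abbrev LiuGroup : Type := Multiplicative ℤ × Multiplicative ℤ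

/-- The generator `g`. -/
def LiuGroup.g : LiuGroup := (Multiplicative.ofAdd 1, 1)

/-- The generator `h`. -/
def LiuGroup.h : LiuGroup := (1, Multiplicative.ofAdd 1)

/-- The data `χ(g) = 1`, `χ(h) = q`, `α = 0` on the group `⟨g, h⟩`, with central element `h`. -/
def liuData (q : kˣ) : HopfOreData k LiuGroup where
  χ := (zpowersHom kˣ q).comp (MonoidHom.snd _ _)
  h := LiuGroup.h
  h_central u := mul_comm _ _
  α _ := 0
  α_mul _ _ := by simp

theorem liuData_χ_g (q : kˣ) : (liuData q).χ LiuGroup.g = 1 := by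
  simp [liuData, LiuGroup.g]

theorem liuData_χ_h (q : kˣ) : (liuData q).χ LiuGroup.h = q := by
  simp [liuData, LiuGroup.h]

/-- The Hopf-Ore extension `H̃ = k⟨g, h⟩(χ, h, 0)`. -/
abbrev HTilde (q : kˣ) : Type _ := HopfOre (liuData q)

/-- The relations `x ^ n = 1 - g ^ w = 1 - h ^ n`. -/
inductive LiuRel (n : ℕ) (w : ℤ) (q : kˣ) : HTilde q → HTilde q → Prop where
  | pow_g : LiuRel n w q (HopfOre.x _ ^ n) (1 - HopfOre.grp _ (LiuGroup.g ^ w))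
  | pow_h : LiuRel n w q (HopfOre.x _ ^ n) (1 - HopfOre.grp _ (LiuGroup.h ^ n))

/-- The generalized Liu algebra `B(n, w, q)`, generated by `g^{±1}`, `h^{±1}`, `x` subject to
`x g = g x`, `x h = q h x`, `g h = h g` (the relations of `H̃`) and
`x ^ n = 1 - g ^ w = 1 - h ^ n`. -/
def GenLiu (n : ℕ) (w : ℤ) (q : kˣ) : Type _ := RingQuot (LiuRel n w q)

namespace GenLiu

variable {n : ℕ} {w : ℤ} {q : kˣ}

instance : Ring (GenLiu n w q) := inferInstanceAs (Ring (RingQuot (LiuRel n w q)))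
instance : Algebra k (GenLiu n w q) := inferInstanceAs (Algebra k (RingQuot (LiuRel n w q)))

/-- The quotient map `H̃ → B(n, w, q)` as an algebra map. -/
def mk (n : ℕ) (w : ℤ) (q : kˣ) : HTilde q →ₐ[k] GenLiu n w q := RingQuot.mkAlgHom k (LiuRel n w q)

theorem mk_surjective : Function.Surjective (mk n w q) := RingQuot.mkAlgHom_surjective k _

theorem algHom_ext {A : Type*} [Ring A] [Algebra k A] {φ ψ : GenLiu n w q →ₐ[k] A}
    (h : φ.comp (mk n w q) = ψ.comp (mk n w q)) : φ = ψ := RingQuot.ringQuot_ext' k φ ψ h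

/-- The images of the elements of `⟨g, h⟩` in `B(n, w, q)`. -/
def grp (n : ℕ) (w : ℤ) (q : kˣ) : LiuGroup →* GenLiu n w q :=
  (mk n w q : HTilde q →* GenLiu n w q).comp (HopfOre.grp (liuData q))

/-- The image of `x` in `B(n, w, q)`. -/
def x (n : ℕ) (w : ℤ) (q : kˣ) : GenLiu n w q := mk n w q (HopfOre.x _)

theorem mk_grp (u : LiuGroup) : mk n w q (HopfOre.grp _ u) = grp n w q u := rfl

theorem mk_x : mk n w q (HopfOre.x _) = x n w q := rfl

theorem x_pow_eq_g : x n w q ^ n = 1 - grp n w q (LiuGroup.g ^ w) := by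
  have h := RingQuot.mkAlgHom_rel k (LiuRel.pow_g (n := n) (w := w) (q := q))
  change mk n w q _ = mk n w q _ at h
  rw [map_pow, map_sub, map_one] at h
  exact h

theorem x_pow_eq_h : x n w q ^ n = 1 - grp n w q (LiuGroup.h ^ n) := by
  have h := RingQuot.mkAlgHom_rel k (LiuRel.pow_h (n := n) (w := w) (q := q))
  change mk n w q _ = mk n w q _ at h
  rw [map_pow, map_sub, map_one] at h
  exact h

theorem grp_g_zpow : grp n w q (LiuGroup.g ^ w) = grp n w q (LiuGroup.h ^ n) :=
  sub_right_injective (x_pow_eq_g.symm.trans x_pow_eq_h)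

theorem x_mul_h : x n w q * grp n w q LiuGroup.h = (q : k) • (grp n w q LiuGroup.h * x n w q) := by
  have h := congrArg (mk n w q) (HopfOre.x_mul_grp (D := liuData q) LiuGroup.h)
  rw [liuData_χ_h, map_mul, map_add, map_smul, map_mul,
    show (liuData q).α LiuGroup.h = 0 from rfl, zero_smul, map_zero, add_zero] at h
  exact h

/-- The universal property of `B(n, w, q)` relative to `H̃`. -/
def lift {A : Type*} [Ring A] [Algebra k A] (φ : HTilde q →ₐ[k] A)
    (hg : φ (HopfOre.x _) ^ n = 1 - φ (HopfOre.grp _ (LiuGroup.g ^ w)))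
    (hh : φ (HopfOre.x _) ^ n = 1 - φ (HopfOre.grp _ (LiuGroup.h ^ n))) :
    GenLiu n w q →ₐ[k] A :=
  RingQuot.liftAlgHom k ⟨φ, by
    intro a b hab
    cases hab with
    | pow_g => rw [map_pow, map_sub, map_one, hg]
    | pow_h => rw [map_pow, map_sub, map_one, hh]⟩

@[simp] theorem lift_mk {A : Type*} [Ring A] [Algebra k A] (φ : HTilde q →ₐ[k] A)
    (hg : φ (HopfOre.x _) ^ n = 1 - φ (HopfOre.grp _ (LiuGroup.g ^ w)))
    (hh : φ (HopfOre.x _) ^ n = 1 - φ (HopfOre.grp _ (LiuGroup.h ^ n))) (a : HTilde q) :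
    lift φ hg hh (mk n w q a) = φ a :=
  RingQuot.liftAlgHom_mkAlgHom_apply k φ _ a

/-- The counit of `B(n, w, q)`, induced by that of `H̃`. -/
def counitHom (n : ℕ) (w : ℤ) (q : kˣ) [hn : Fact (1 < n)] : GenLiu n w q →ₐ[k] k :=
  lift (Bialgebra.counitAlgHom k _)
    (by simp [zero_pow (by have := hn.out; omega : n ≠ 0)])
    (by simp [zero_pow (by have := hn.out; omega : n ≠ 0)])

theorem counitHom_mk [Fact (1 < n)] (a : HTilde q) :
    counitHom n w q (mk n w q a) = Coalgebra.counit (R := k) a :=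
  lift_mk _ _ _ a

theorem counitHom_grp [Fact (1 < n)] (u : LiuGroup) : counitHom n w q (grp n w q u) = 1 :=
  (counitHom_mk _).trans (HopfOre.counit_grp u)

theorem counitHom_x [Fact (1 < n)] : counitHom n w q (x n w q) = 0 :=
  (counitHom_mk _).trans HopfOre.counit_x

variable [hn : Fact (1 < n)] [hq : Fact (IsPrimitiveRoot q n)]

/-- `Δ(x) ^ n = 1 ⊗ x ^ n + x ^ n ⊗ h ^ n`. -/
theorem comul_x_pow :
    ((1 : GenLiu n w q) ⊗ₜ[k] x n w q + x n w q ⊗ₜ[k] grp n w q LiuGroup.h) ^ n =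
      (1 : GenLiu n w q) ⊗ₜ[k] (x n w q ^ n) + (x n w q ^ n) ⊗ₜ[k] grp n w q (LiuGroup.h ^ n) := by
  have hq' : IsPrimitiveRoot (q : k) n := IsPrimitiveRoot.coe_units_iff.mpr hq.out
  rw [add_pow_of_qComm (lt_trans Nat.zero_lt_one hn.out) hq', Algebra.TensorProduct.tmul_pow,
    Algebra.TensorProduct.tmul_pow, one_pow, map_pow]
  rw [Algebra.TensorProduct.tmul_mul_tmul, Algebra.TensorProduct.tmul_mul_tmul, one_mul, mul_one,
    x_mul_h, TensorProduct.tmul_smul]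

/-- The comultiplication of `B(n, w, q)`, induced by that of `H̃`. -/
def comulHom (n : ℕ) (w : ℤ) (q : kˣ) [Fact (1 < n)] [Fact (IsPrimitiveRoot q n)] :
    GenLiu n w q →ₐ[k] GenLiu n w q ⊗[k] GenLiu n w q :=
  lift ((Algebra.TensorProduct.map (mk n w q) (mk n w q)).comp (Bialgebra.comulAlgHom k _))
    (by
      simp only [AlgHom.comp_apply, Bialgebra.comulAlgHom_apply, HopfOre.comul_x,
        HopfOre.comul_grp, map_add, Algebra.TensorProduct.map_tmul, map_one, mk_x, mk_grp]
      change (1 ⊗ₜ[k] x n w q + x n w q ⊗ₜ[k] grp n w q LiuGroup.h) ^ n = _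
      rw [comul_x_pow, x_pow_eq_h, grp_g_zpow, TensorProduct.tmul_sub, TensorProduct.sub_tmul,
        ← Algebra.TensorProduct.one_def]
      abel)
    (by
      simp only [AlgHom.comp_apply, Bialgebra.comulAlgHom_apply, HopfOre.comul_x,
        HopfOre.comul_grp, map_add, Algebra.TensorProduct.map_tmul, map_one, mk_x, mk_grp]
      change (1 ⊗ₜ[k] x n w q + x n w q ⊗ₜ[k] grp n w q LiuGroup.h) ^ n = _
      rw [comul_x_pow, x_pow_eq_h, TensorProduct.tmul_sub, TensorProduct.sub_tmul,
        ← Algebra.TensorProduct.one_def]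
      abel)

theorem comulHom_grp (u : LiuGroup) :
    comulHom n w q (grp n w q u) = grp n w q u ⊗ₜ[k] grp n w q u := by
  rw [← mk_grp, comulHom, lift_mk]
  simp [mk_grp]

theorem comulHom_x : comulHom n w q (x n w q) =
    1 ⊗ₜ[k] x n w q + x n w q ⊗ₜ[k] grp n w q LiuGroup.h := by
  rw [← mk_x, comulHom, lift_mk]
  simp only [AlgHom.comp_apply, Bialgebra.comulAlgHom_apply, HopfOre.comul_x, map_add,
    Algebra.TensorProduct.map_tmul, map_one, mk_x, mk_grp]
  rfl

theorem comulHom_mk (a : HTilde q) : comulHom n w q (mk n w q a) =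
    TensorProduct.map (mk n w q).toLinearMap (mk n w q).toLinearMap (Coalgebra.comul (R := k) a) :=
  lift_mk _ _ _ a

instance : Bialgebra k (GenLiu n w q) :=
  Bialgebra.ofAlgHom (comulHom n w q) (counitHom n w q)
    (by
      apply algHom_ext
      apply HopfOre.algHom_ext
      · intro u
        simp [mk_grp, comulHom_grp]
      · simp [mk_x, comulHom_x, comulHom_grp, TensorProduct.tmul_add, TensorProduct.add_tmul,
          Algebra.TensorProduct.one_def]
        abel)
    (by
      apply algHom_ext
      apply HopfOre.algHom_ext
      · intro u
        simp [mk_grp, comulHom_grp, counitHom_grp]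
      · simp [mk_x, comulHom_x, counitHom_x])
    (by
      apply algHom_ext
      apply HopfOre.algHom_ext
      · intro u
        simp [mk_grp, comulHom_grp, counitHom_grp]
      · simp [mk_x, comulHom_x, counitHom_grp, counitHom_x])

theorem comul_mk (a : HTilde q) : Coalgebra.comul (R := k) (mk n w q a) =
    TensorProduct.map (mk n w q).toLinearMap (mk n w q).toLinearMap (Coalgebra.comul (R := k) a) :=
  comulHom_mk a

theorem counit_mk (a : HTilde q) :
    Coalgebra.counit (R := k) (mk n w q a) = Coalgebra.counit (R := k) a :=
  counitHom_mk a

@[simp] theorem comul_grp (u : LiuGroup) :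
    Coalgebra.comul (R := k) (grp n w q u) = grp n w q u ⊗ₜ[k] grp n w q u := comulHom_grp u

@[simp] theorem comul_x : Coalgebra.comul (R := k) (x n w q) =
    1 ⊗ₜ[k] x n w q + x n w q ⊗ₜ[k] grp n w q LiuGroup.h := comulHom_x

/-- The projection `H̃ → B(n, w, q)` as a homomorphism of bialgebras: it is the identity on
the generators `g`, `h`, `x`. -/
def proj (n : ℕ) (w : ℤ) (q : kˣ) [Fact (1 < n)] [Fact (IsPrimitiveRoot q n)] :
    HTilde q →ₐc[k] GenLiu n w q :=
  BialgHom.ofAlgHom (mk n w q)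
    (by ext a; exact counit_mk a)
    (by ext a; exact (comul_mk a).symm)

theorem antipode_x_pow :
    (-(x n w q * grp n w q LiuGroup.h⁻¹)) ^ n = 1 - grp n w q (LiuGroup.h ^ n)⁻¹ := by
  have hq' : IsPrimitiveRoot (q : k) n := IsPrimitiveRoot.coe_units_iff.mpr hq.out
  have h1 : grp n w q LiuGroup.h⁻¹ * grp n w q LiuGroup.h = 1 := by
    rw [← map_mul, inv_mul_cancel, map_one]
  have h2 : grp n w q LiuGroup.h * grp n w q LiuGroup.h⁻¹ = 1 := by
    rw [← map_mul, mul_inv_cancel, map_one]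
  have h3 : grp n w q LiuGroup.h⁻¹ * x n w q =
      (q : k) • (x n w q * grp n w q LiuGroup.h⁻¹) := by
    have h4 := congrArg (fun z => grp n w q LiuGroup.h⁻¹ * z * grp n w q LiuGroup.h⁻¹)
      (x_mul_h (n := n) (w := w) (q := q))
    simp only [mul_smul_comm, smul_mul_assoc] at h4
    rw [mul_assoc, mul_assoc, h2, mul_one, ← mul_assoc (grp n w q LiuGroup.h⁻¹), h1, one_mul] at h4
    exact h4
  rw [neg_mul_pow_of_qComm (lt_trans Nat.zero_lt_one hn.out) hq' h3, x_pow_eq_h, ← map_pow,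
    sub_mul, one_mul, ← map_mul, inv_pow, mul_inv_cancel, map_one, neg_sub]

/-- The antipode of `B(n, w, q)`, induced by that of `H̃`. -/
def antipodeHom (n : ℕ) (w : ℤ) (q : kˣ) [Fact (1 < n)] [Fact (IsPrimitiveRoot q n)] :
    GenLiu n w q →ₐ[k] (GenLiu n w q)ᵐᵒᵖ :=
  lift ((AlgHom.op (mk n w q)).comp (HopfOre.antipodeHom (liuData q)))
    (by
      apply MulOpposite.unop_injective
      have h : grp n w q (LiuGroup.g ^ w)⁻¹ = grp n w q (LiuGroup.h ^ n)⁻¹ := by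
        rw [← mul_one (grp n w q (LiuGroup.g ^ w)⁻¹), ← map_one (grp n w q),
          ← mul_inv_cancel (LiuGroup.h ^ n), map_mul, ← grp_g_zpow, ← mul_assoc, ← map_mul,
          inv_mul_cancel, map_one, one_mul]
      simp only [HopfOre.antipodeHom, AlgHom.comp_apply, HopfOre.lift_x, HopfOre.lift_grp,
        HopfOre.grpInv_apply, AlgHom.op_apply_apply, MulOpposite.unop_pow, MulOpposite.unop_sub,
        MulOpposite.unop_one, MulOpposite.unop_op, map_neg, map_mul, mk_x, mk_grp]
      rw [h]
      exact antipode_x_pow)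
    (by
      apply MulOpposite.unop_injective
      simp only [HopfOre.antipodeHom, AlgHom.comp_apply, HopfOre.lift_x, HopfOre.lift_grp,
        HopfOre.grpInv_apply, AlgHom.op_apply_apply, MulOpposite.unop_pow, MulOpposite.unop_sub,
        MulOpposite.unop_one, MulOpposite.unop_op, map_neg, map_mul, mk_x, mk_grp]
      exact antipode_x_pow)

instance : HopfAlgebraStruct k (GenLiu n w q) where
  antipode := antiLinear (antipodeHom n w q)

instance : HopfAlgebra k (GenLiu n w q) :=
  HopfAlgebra.ofSurjective (proj n w q) mk_surjective (by
    ext a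
    change ((antipodeHom n w q) (mk n w q a)).unop = mk n w q (HopfOre.antipodeHom _ a).unop
    rw [antipodeHom, lift_mk]
    rfl)

end GenLiu

end GeneralizedLiu

/-! ### The action on the vertices -/

/-- The data of an action `ρ` of `k G(χ, h, α)` on `k Q₀ = ⨁ k eᵢ` (the algebra of functions on
the finite set `Q₀`, with `eᵢ` the indicator function of `i`): the permutation action `perm` of `G`
on `Q₀` with `u · eᵢ = e_{u · i}`, and the scalars `γ` with `γ_{u · i} = χ(u) γᵢ + α(u)` and
`x · eᵢ = γᵢ eᵢ - (χ(h) γᵢ + α(h)) e_{h · i}`. -/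
structure IsVertexData {Q₀ : Type*} [DecidableEq Q₀] {D : HopfOreData k G}
    (ρ : HopfAction k (HopfOre D) (Q₀ → k)) (perm : G →* Equiv.Perm Q₀) (γ : Q₀ → k) : Prop where
  grp_act : ∀ (u : G) (i : Q₀),
    ρ.act (HopfOre.grp D u) (Pi.single i 1) = Pi.single (perm u i) 1
  scalar : ∀ (u : G) (i : Q₀), γ (perm u i) = D.χ u * γ i + D.α u
  x_act : ∀ i : Q₀, ρ.act (HopfOre.x D) (Pi.single i 1) =
    γ i • Pi.single i 1 - (D.χ D.h * γ i + D.α D.h) • Pi.single (perm D.h i) 1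

end

/-! Grouplike elements act on `Q₀ → k` by algebra automorphisms. Since every algebra map `(Q₀ → k)
→ₐ[k] k` is evaluation at a vertex (`exists_eq_eval_of_algHom_pi`), these automorphisms permute the
idempotents `eᵢ`.

The variable `x` acts as a skew derivation, `x(pr) = p x(r) + x(p) h(r)`. Applied to `eᵢ eⱼ = 0` and
`eⱼ eⱼ = eⱼ`, this rule leaves `x eⱼ = γⱼ eⱼ - γ_{hj} e_{hj}`, with `γⱼ` the diagonal coefficient
(`skewDerivation_single`). Comparing coefficients in `x u = χ(u) u x` gives `γ_{ui} = χ(u) γᵢ`. The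
`γᵢ` are unique: if `h i ≠ i` then `γᵢ` is read off `x eᵢ`, and if `h i = i` then `γᵢ = q γᵢ` with
`q ≠ 1`, so `γᵢ = 0`.

For the factorization, let `Γ` be multiplication by `γ`. Then `x = Γ - q h Γ` and `Γ h = q h Γ`, so
the mixed terms of the `q`-binomial expansion vanish at a primitive `n`-th root of unity. Hence `xⁿ
eᵢ = γᵢⁿ (eᵢ - e_{hⁿ i})` (`IsVertexData.x_act_pow`). Comparing with `eᵢ - e_{hⁿ i}` and `eᵢ -
e_{g^w i}` yields the two conditions. -/

open scoped TensorProduct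

/-! ### Grouplike elements act by permutations of the vertices -/

namespace HopfAction

variable {k G Q₀ : Type*} [Field k] [Group G] {D : HopfOreData k G}

theorem grp_act_mul {A : Type*} [Ring A] [Algebra k A] (ρ : HopfAction k (HopfOre D) A) (u : G)
    (a b : A) :
    ρ.act (HopfOre.grp D u) (a * b) = ρ.act (HopfOre.grp D u) a * ρ.act (HopfOre.grp D u) b := by
  rw [ρ.act_mul, HopfOre.comul_grp]
  simp

/-- The coproduct `1 ⊗ x + x ⊗ h` read as a twisted Leibniz rule; this is the hypothesis `hX` of
`skewDerivation_single`. -/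
theorem x_act_mul {A : Type*} [Ring A] [Algebra k A] (ρ : HopfAction k (HopfOre D) A) (a b : A) :
    ρ.act (HopfOre.x D) (a * b) =
      a * ρ.act (HopfOre.x D) b + ρ.act (HopfOre.x D) a * ρ.act (HopfOre.grp D D.h) b := by
  rw [ρ.act_mul, HopfOre.comul_x]
  simp

/-- A grouplike element acts by an algebra endomorphism. -/
def grpAlgHom {A : Type*} [Ring A] [Algebra k A] (ρ : HopfAction k (HopfOre D) A) (u : G) :
    A →ₐ[k] A :=
  AlgHom.ofLinearMap (ρ.act (HopfOre.grp D u)) (by rw [ρ.act_one, HopfOre.counit_grp, map_one])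
    (ρ.grp_act_mul u)

end HopfAction

/-- The algebra maps from a finite power of a field to the field are the projections. -/
theorem exists_eq_eval_of_algHom_pi {k Q₀ : Type*} [Field k] [Finite Q₀]
    (φ : (Q₀ → k) →ₐ[k] k) : ∃ i, ∀ f, φ f = f i := by
  classical
  cases nonempty_fintype Q₀
  -- The `eᵢ` sum to `1` and `φ 1 = 1`, so `φ` cannot kill all of them. Then `f eᵢ = f(i) eᵢ`
  -- determines `φ f`.
  obtain ⟨i, hi⟩ : ∃ i, φ (Pi.single i 1) ≠ 0 := by
    by_contra! h
    have h1 : φ 1 = ∑ i : Q₀, φ (Pi.single i 1) := by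
      rw [← map_sum]
      congr 1
      exact (Finset.univ_sum_single (1 : Q₀ → k)).symm
    simp [h] at h1
  refine ⟨i, fun f => mul_right_cancel₀ hi ?_⟩
  rw [← map_mul, show f * Pi.single i 1 = f i • Pi.single i (1 : k) by
    ext m; by_cases hm : m = i <;> simp [hm], map_smul, smul_eq_mul]

namespace HopfAction

variable {k G Q₀ : Type*} [Field k] [Group G] {D : HopfOreData k G} [Finite Q₀]

/-- The action of `u` followed by evaluation at `m` is an algebra map to `k`, hence evaluation at
another vertex `s u m`. -/
theorem exists_grp_act_eq_comp (ρ : HopfAction k (HopfOre D) (Q₀ → k)) :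
    ∃ s : G → Q₀ → Q₀, ∀ u f, ρ.act (HopfOre.grp D u) f = f ∘ s u := by
  choose s hs using fun (u : G) (m : Q₀) =>
    exists_eq_eval_of_algHom_pi ((Pi.evalAlgHom k (fun _ : Q₀ => k) m).comp (ρ.grpAlgHom u))
  exact ⟨s, fun u f => funext fun m => hs u m f⟩

theorem exists_perm [DecidableEq Q₀] (ρ : HopfAction k (HopfOre D) (Q₀ → k)) :
    ∃ perm : G →* Equiv.Perm Q₀, ∀ (u : G) (i : Q₀),
      ρ.act (HopfOre.grp D u) (Pi.single i 1) = Pi.single (perm u i) 1 := by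
  obtain ⟨s, hs⟩ := ρ.exists_grp_act_eq_comp
  have hinj : ∀ a b : Q₀, (∀ f : Q₀ → k, f a = f b) → a = b := by
    intro a b h
    by_contra hab
    simpa [Pi.single_apply, hab] using h (Pi.single b 1)
  have h1 : ∀ m, s 1 m = m := by
    intro m
    refine hinj _ _ fun f => ?_
    have := congrFun (hs 1 f) m
    rw [map_one, map_one] at this
    exact this.symm
  have hmul : ∀ u v m, s (u * v) m = s v (s u m) := by
    intro u v m
    refine hinj _ _ fun f => ?_
    have := congrFun (hs (u * v) f) m
    rw [map_mul, map_mul, Module.End.mul_apply, hs v, hs u] at this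
    exact this.symm
  -- Precomposition reverses the order, so `s` is a right action by `hmul`; inverting `u` turns it
  -- into a left action.
  let _ : MulAction G Q₀ :=
    { smul u := s u⁻¹
      one_smul m := by change s 1⁻¹ m = m; rw [inv_one, h1]
      mul_smul u v m := by
        change s (u * v)⁻¹ m = s u⁻¹ (s v⁻¹ m)
        rw [mul_inv_rev, hmul] }
  refine ⟨MulAction.toPermHom G Q₀, fun u i => ?_⟩
  rw [hs]
  ext m
  have hiff : s u m = i ↔ m = s u⁻¹ i := by
    constructor
    · rintro rfl
      rw [← hmul, mul_inv_cancel, h1]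
    · rintro rfl
      rw [← hmul, inv_mul_cancel, h1]
  change (Pi.single i 1 : Q₀ → k) (s u m) = (Pi.single (s u⁻¹ i) 1 : Q₀ → k) m
  simp only [Pi.single_apply, hiff]

end HopfAction

/-! ### A `q`-commuting power identity, and skew derivations on the idempotents -/

section VertexAlgebra

variable {k Q₀ : Type*} [Field k]

/-- The summands `Y` and `-q Z Y` again `q`-commute, so only their `n`-th powers survive; the sign
and the power of `q` from reordering `(-Z Y)ⁿ` combine to `-1`, and `qⁿ = 1` removes the scalar. It
is applied with `Y = Γ` and `Z = h`. -/
theorem sub_smul_mul_pow_of_qComm {R : Type*} [Ring R] [Algebra k R] {q : k} {n : ℕ} (hn : 0 < n)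
    (hq : IsPrimitiveRoot q n) {Y Z : R} (h : Y * Z = q • (Z * Y)) :
    (Y - q • (Z * Y)) ^ n = Y ^ n - Z ^ n * Y ^ n := by
  have hcomm : Y * -(q • (Z * Y)) = q • (-(q • (Z * Y)) * Y) := by
    rw [mul_neg, mul_smul_comm, ← mul_assoc, h, neg_mul, smul_neg, smul_mul_assoc]
  rw [sub_eq_add_neg, add_pow_of_qComm hn hq hcomm, ← smul_neg, smul_pow, hq.pow_eq_one, one_smul,
    neg_mul_pow_of_qComm hn hq h, ← sub_eq_add_neg]

variable [DecidableEq Q₀]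

/-- An operator `X` on `⨁ k eᵢ` with `X (p r) = p X(r) + X(p) H(r)`, where `H eᵢ = e_{σ i}`, is
determined by its diagonal coefficients. -/
theorem skewDerivation_single (X H : Module.End k (Q₀ → k)) (σ : Q₀ → Q₀)
    (hX : ∀ p r, X (p * r) = p * X r + X p * H r)
    (hH : ∀ i, H (Pi.single i 1) = Pi.single (σ i) 1) (j : Q₀) :
    X (Pi.single j 1) = (X (Pi.single j 1) j) • Pi.single j 1 -
      (X (Pi.single (σ j) 1) (σ j)) • Pi.single (σ j) 1 := by
  -- The Leibniz rule applied to `eᵢ eⱼ = 0`, evaluated at `m`. Below it is used only with `i = m`.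
  have hne : ∀ i m, i ≠ j → 0 = (Pi.single i 1 : Q₀ → k) m * X (Pi.single j 1) m +
      X (Pi.single i 1) m * (Pi.single (σ j) 1 : Q₀ → k) m := by
    intro i m hij
    have h := congrFun (hX (Pi.single i 1) (Pi.single j 1)) m
    rw [hH, show (Pi.single i 1 : Q₀ → k) * Pi.single j 1 = 0 by
      ext a; by_cases ha : a = i <;> simp [Pi.single_apply, ha, hij], map_zero] at h
    exact h
  ext m
  -- At a fixed point the two terms on the right cancel, so `X eⱼ = 0` is required; its diagonal
  -- coefficient `c` vanishes because `eⱼ eⱼ = eⱼ` gives `c = c + c`.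
  by_cases hσ : σ j = j
  · simp only [hσ, sub_self, Pi.zero_apply]
    by_cases hm : m = j
    · subst hm
      have h := congrFun (hX (Pi.single m 1) (Pi.single m 1)) m
      rw [hH, hσ, show (Pi.single m 1 : Q₀ → k) * Pi.single m 1 = Pi.single m 1 by
        ext a; by_cases ha : a = m <;> simp [ha]] at h
      simpa using h
    · simpa [hσ, hm] using (hne m m hm).symm
  · by_cases hm : m = j
    · subst hm
      simp [Ne.symm hσ]
    · by_cases hm' : m = σ j
      · subst hm'
        -- The coefficient of `X eⱼ` at `σ j` is minus the diagonal coefficient of `X e_{σ j}`.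
        have h := hne (σ j) (σ j) hm
        simp only [Pi.single_eq_same, one_mul, mul_one] at h
        simp only [Pi.sub_apply, Pi.smul_apply, Pi.single_eq_same, smul_eq_mul, mul_one,
          Pi.single_eq_of_ne hm, mul_zero, zero_sub]
        linear_combination -h
      · simpa [hm, hm'] using (hne m m hm).symm

theorem single_one_injective : Function.Injective fun i : Q₀ => (Pi.single i 1 : Q₀ → k) := by
  intro a b h
  by_contra hab
  simpa [Pi.single_apply, hab] using congrFun h a

/-! ### Vertex data: existence, uniqueness, and the `n`-th power of `x` -/

section Liu

variable {q : kˣ}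

theorem exists_isVertexData [Finite Q₀] (ρ : HopfAction k (HTilde q) (Q₀ → k)) :
    ∃ (perm : LiuGroup →* Equiv.Perm Q₀) (γ : Q₀ → k), IsVertexData ρ perm γ := by
  obtain ⟨perm, hperm⟩ := ρ.exists_perm
  have hX := skewDerivation_single (ρ.act (HopfOre.x _)) (ρ.act (HopfOre.grp _ LiuGroup.h))
    (perm LiuGroup.h) ρ.x_act_mul (hperm _)
  -- Apply `x u = χ(u) u x` to `eᵢ` and compare coefficients at `u i`.
  have hscalar : ∀ (u : LiuGroup) (i : Q₀),
      ρ.act (HopfOre.x _) (Pi.single (perm u i) 1) (perm u i) =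
        (liuData q).χ u * ρ.act (HopfOre.x _) (Pi.single i 1) i := by
    intro u i
    have h := congrArg (fun z => ρ.act z (Pi.single i 1) (perm u i))
      (HopfOre.x_mul_grp (D := liuData q) u)
    rw [show (liuData q).α u = 0 from rfl, zero_smul, add_zero] at h
    simp only [map_mul, map_smul, Module.End.mul_apply, LinearMap.smul_apply, hperm] at h
    rw [h, hX i, map_sub, map_smul, map_smul, hperm, hperm, Pi.smul_apply, Pi.sub_apply,
      Pi.smul_apply, Pi.smul_apply, ← hX i]
    -- The term at `u h i` contributes to the coefficient at `u i` only if `h i = i`, and then the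
    -- diagonal coefficient at `i` is zero.
    by_cases hi : perm LiuGroup.h i = i
    · have h0 : ρ.act (HopfOre.x _) (Pi.single i 1) i = 0 := by
        have := congrFun (hX i) i
        rwa [hi, sub_self] at this
      simp [hi, h0]
    · have h1 : perm u i ≠ perm u (perm LiuGroup.h i) := fun h =>
        hi ((perm u).injective h).symm
      simp [h1]
  refine ⟨perm, fun i => ρ.act (HopfOre.x _) (Pi.single i 1) i, hperm, fun u i => ?_, fun i => ?_⟩
  · rw [hscalar, show (liuData q).α u = 0 from rfl, add_zero]
  · rw [show (liuData q).α _ = 0 from rfl, add_zero, ← hscalar]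
    exact hX i

namespace IsVertexData

variable {ρ : HopfAction k (HTilde q) (Q₀ → k)} {perm : LiuGroup →* Equiv.Perm Q₀} {γ : Q₀ → k}

theorem scalar_h (hd : IsVertexData ρ perm γ) (i : Q₀) : γ (perm LiuGroup.h i) = q * γ i := by
  rw [hd.scalar, liuData_χ_h, show (liuData q).α _ = 0 from rfl, add_zero]

theorem x_act' (hd : IsVertexData ρ perm γ) (i : Q₀) : ρ.act (HopfOre.x _) (Pi.single i 1) =
    γ i • Pi.single i 1 - (q * γ i) • Pi.single (perm LiuGroup.h i) 1 := by
  have h := hd.x_act i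
  rwa [show (liuData q).h = LiuGroup.h from rfl, liuData_χ_h,
    show (liuData q).α _ = 0 from rfl, add_zero] at h

/-- The right side involves only `ρ` and `perm`, so `γ` is unique once `perm` is. At a vertex fixed
by `h`, the scaling rule reads `γᵢ = q γᵢ`. -/
theorem scalar_eq (hq : (q : k) ≠ 1) (hd : IsVertexData ρ perm γ) (i : Q₀) :
    γ i = if perm LiuGroup.h i = i then 0 else ρ.act (HopfOre.x _) (Pi.single i 1) i := by
  split_ifs with hi
  · have h := hd.scalar_h i
    rw [hi] at h
    have h' : (1 - (q : k)) * γ i = 0 := by linear_combination h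
    exact (mul_eq_zero.mp h').resolve_left (sub_ne_zero.mpr hq.symm)
  · rw [hd.x_act']
    simp [Ne.symm hi]

theorem perm_eq {perm' : LiuGroup →* Equiv.Perm Q₀} {γ' : Q₀ → k} (hd : IsVertexData ρ perm γ)
    (hd' : IsVertexData ρ perm' γ') : perm = perm' := by
  ext u i
  exact single_one_injective (k := k) ((hd.grp_act u i).symm.trans (hd'.grp_act u i))

/-- With `Γ eᵢ = γᵢ eᵢ`, the variable `x` acts as `Γ - q h Γ`, where `Γ h = q h Γ`. -/
theorem x_act_pow [Finite Q₀] {n : ℕ} (hn : 0 < n) (hq : IsPrimitiveRoot (q : k) n)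
    (hd : IsVertexData ρ perm γ) (i : Q₀) :
    (ρ.act (HopfOre.x _) ^ n) (Pi.single i 1) =
      γ i ^ n • (Pi.single i 1 - Pi.single (perm (LiuGroup.h ^ n) i) 1) := by
  set H := ρ.act (HopfOre.grp _ LiuGroup.h) with hH
  let Γ : Module.End k (Q₀ → k) := LinearMap.mulLeft k γ
  have hΓ : ∀ j, Γ (Pi.single j 1) = γ j • Pi.single j 1 := by
    intro j
    ext m
    by_cases hm : m = j
    · subst hm; simp [Γ]
    · simp [Γ, hm]
  have hΓH : Γ * H = (q : k) • (H * Γ) := by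
    refine LinearMap.pi_ext' fun j => LinearMap.ext_ring ?_
    change Γ (H (Pi.single j 1)) = (q : k) • H (Γ (Pi.single j 1))
    rw [hH, hd.grp_act, hΓ, hΓ, map_smul, hd.grp_act, hd.scalar_h, smul_smul]
  have hX : ρ.act (HopfOre.x _) = Γ - (q : k) • (H * Γ) := by
    refine LinearMap.pi_ext' fun j => LinearMap.ext_ring ?_
    change ρ.act (HopfOre.x _) (Pi.single j 1) =
      Γ (Pi.single j 1) - (q : k) • H (Γ (Pi.single j 1))
    rw [hd.x_act', hΓ, map_smul, hH, hd.grp_act, smul_smul]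
  have hΓpow : (Γ ^ n) (Pi.single i 1) = γ i ^ n • Pi.single i 1 := by
    -- Primitivity concerns the given `n` only and must not enter the induction. Positivity of the
    -- exponent does enter it, which is why exponent `1` is treated separately below.
    clear hq
    induction n with
    | zero => simp
    | succ m ih =>
      rcases Nat.eq_zero_or_pos m with rfl | hm
      · simp [hΓ]
      · rw [pow_succ, Module.End.mul_apply, hΓ, map_smul, ih hm, smul_smul, pow_succ']
  rw [hX, sub_smul_mul_pow_of_qComm hn hq hΓH, LinearMap.sub_apply, Module.End.mul_apply, hΓpow,
    map_smul, hH, ← map_pow, ← map_pow, hd.grp_act, smul_sub]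

end IsVertexData

/-- An action of `H̃` factors through `B(n, w, q)` as soon as it satisfies the relations. -/
theorem factorsThrough_proj_iff {n : ℕ} {w : ℤ} [Fact (1 < n)] [Fact (IsPrimitiveRoot q n)]
    {A : Type*} [Ring A] [Algebra k A] (ρ : HopfAction k (HTilde q) A) :
    ρ.FactorsThrough (GenLiu.proj n w q) ↔
      ρ.act (HopfOre.x _) ^ n = 1 - ρ.act (HopfOre.grp _ (LiuGroup.g ^ w)) ∧
      ρ.act (HopfOre.x _) ^ n = 1 - ρ.act (HopfOre.grp _ (LiuGroup.h ^ n)) := by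
  constructor
  · rintro ⟨ρ', hρ⟩
    have h : ∀ u, ρ.act u = ρ'.act (GenLiu.mk n w q u) := fun u => LinearMap.ext (hρ u)
    simp only [h, GenLiu.mk_x, GenLiu.mk_grp]
    constructor
    · rw [← map_pow, GenLiu.x_pow_eq_g, map_sub, map_one]
    · rw [← map_pow, GenLiu.x_pow_eq_h, map_sub, map_one]
  · rintro ⟨hg, hh⟩
    refine ⟨⟨GenLiu.lift ρ.act hg hh, fun u a b => ?_, fun u => ?_⟩, fun u a => ?_⟩
    -- The action axioms descend because the projection is surjective and respects comultiplication
    -- and counit.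
    · obtain ⟨u, rfl⟩ := GenLiu.mk_surjective u
      have hflip : ∀ c, (GenLiu.lift ρ.act hg hh).toLinearMap.flip c ∘ₗ
          (GenLiu.mk n w q).toLinearMap = ρ.act.toLinearMap.flip c := fun c =>
        LinearMap.ext fun v => LinearMap.congr_fun (GenLiu.lift_mk ρ.act hg hh v) c
      rw [GenLiu.lift_mk, ρ.act_mul, GenLiu.comul_mk, TensorProduct.map_map, hflip, hflip]
    · obtain ⟨u, rfl⟩ := GenLiu.mk_surjective u
      rw [GenLiu.lift_mk, ρ.act_one, GenLiu.counit_mk]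
    · change _ = GenLiu.lift ρ.act hg hh (GenLiu.mk n w q u) a
      rw [GenLiu.lift_mk]

end Liu

end VertexAlgebra

/-! ### The theorem: comparing the relations on the basis `eᵢ` -/

theorem mainTheorem5 {k : Type*} [Field k] (n : ℕ) [Fact (1 < n)] (w : ℤ)
    (q : kˣ) [Fact (IsPrimitiveRoot q n)] {Q₀ : Type*} [Finite Q₀] [DecidableEq Q₀]
    (ρ : HopfAction k (HTilde q) (Q₀ → k)) :
    (∃! d : (LiuGroup →* Equiv.Perm Q₀) × (Q₀ → k), IsVertexData ρ d.1 d.2) ∧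
    ∀ (perm : LiuGroup →* Equiv.Perm Q₀) (γ : Q₀ → k), IsVertexData ρ perm γ →
      (ρ.FactorsThrough (GenLiu.proj n w q) ↔
        ∀ i : Q₀,
          (perm (LiuGroup.h ^ n) i ≠ i → γ i ^ n = 1) ∧
          perm (LiuGroup.g ^ w) i = perm (LiuGroup.h ^ n) i) := by
  have hn : 1 < n := Fact.out
  have hq : IsPrimitiveRoot (q : k) n := IsPrimitiveRoot.coe_units_iff.mpr Fact.out
  constructor
  · obtain ⟨perm, γ, hd⟩ := exists_isVertexData ρ
    refine ⟨(perm, γ), hd, ?_⟩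
    rintro ⟨perm', γ'⟩ hd'
    obtain rfl : perm = perm' := hd.perm_eq hd'
    refine Prod.ext rfl (funext fun i => ?_)
    exact (hd'.scalar_eq (hq.ne_one hn) i).trans (hd.scalar_eq (hq.ne_one hn) i).symm
  · intro perm γ hd
    -- Both relations have the form `xⁿ = 1 - u`, with `u = g^w` or `u = hⁿ`, and can be tested on
    -- each `eᵢ`.
    have hrel : ∀ u : LiuGroup,
        ρ.act (HopfOre.x _) ^ n = 1 - ρ.act (HopfOre.grp _ u) ↔
          ∀ i, γ i ^ n • (Pi.single i 1 - Pi.single (perm (LiuGroup.h ^ n) i) 1 : Q₀ → k) =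
            Pi.single i 1 - Pi.single (perm u i) 1 := by
      intro u
      have hu : ∀ i, (1 - ρ.act (HopfOre.grp _ u)) (Pi.single i 1) =
          Pi.single i 1 - Pi.single (perm u i) 1 := fun i => by
        rw [LinearMap.sub_apply, hd.grp_act, Module.End.one_apply]
      constructor
      · intro h i
        rw [← hd.x_act_pow (zero_lt_one.trans hn) hq, h, hu]
      · intro h
        refine LinearMap.pi_ext' fun i => LinearMap.ext_ring ?_
        exact (hd.x_act_pow (zero_lt_one.trans hn) hq i).trans ((h i).trans (hu i).symm)
    rw [factorsThrough_proj_iff, hrel, hrel]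
    constructor
    · rintro ⟨hg, hh⟩ i
      refine ⟨fun hi => ?_, ?_⟩
      -- Since `hⁿ i ≠ i`, the coefficient of `eᵢ` in the `hⁿ` relation is `γᵢⁿ` on the left and `1`
      -- on the right.
      · have h := congrFun (hh i) i
        rw [Pi.smul_apply, Pi.sub_apply, Pi.single_eq_same, Pi.single_eq_of_ne hi.symm] at h
        simpa using h
      -- The two relations share their left side, so `e_{g^w i} = e_{hⁿ i}`.
      · exact single_one_injective (k := k) (sub_right_injective ((hg i).symm.trans (hh i)))
    · intro h
      have hh : ∀ i, γ i ^ n • (Pi.single i 1 - Pi.single (perm (LiuGroup.h ^ n) i) 1 : Q₀ → k) =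
          Pi.single i 1 - Pi.single (perm (LiuGroup.h ^ n) i) 1 := by
        intro i
        -- If `hⁿ i = i`, both sides vanish whatever `γᵢ` is.
        by_cases hi : perm (LiuGroup.h ^ n) i = i
        · rw [hi, sub_self, smul_zero]
        · rw [(h i).1 hi, one_smul]
      refine ⟨fun i => ?_, hh⟩
      rw [(h i).2]
      exact hh i
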